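/- Let $\{Y_n\}_{n\ge 1}$ be a (strictly) stationary process of real random variables with finite variance, taking values in a discrete alphabet $\mathcal Y\subset\mathbb R$ any two distinct points of which are at distance at least $1$ (for example, an integer-valued process). Let $\mu=\mathbb E[Y_n]$ and $R_Y(k)=\mathbb E[(Y_{n+k}-\mu)(Y_n-\mu)]$, $k\in\mathbb Z$, be its mean and covariance function; assume that $\sum_{k\in\mathbb Z}|R_Y(k)|<\infty$, and let $$\Phi_Y(\lambda)=\sum_{k=-\infty}^{\infty}R_Y(k)\,e^{i\lambda k},\qquad \lambda\in\mathbb R,$$ be its power spectral density function. Then the entropy rate $$\bar H(Y)=\lim_{n\to\infty}\frac{H(Y_1,\dots,Y_n)}{n}$$ exists and is finite, where $H(Y_1,\dots,Y_n)=-\sum_{y\in\mathcal Y^n}P(y)\log P(y)$ is the joint Shannon entropy in nats, with $P(y)=\Pr\{(Y_1,\dots,Y_n)=y\}$ and $0\log 0=0$, and $$\bar H(Y)\le \frac12\log(2\pi e)+\frac1{4\pi}\int_0^{2\pi}\log\Big(\Phi_Y(\lambda)+\frac1{12}\Big)\,d\lambda .$$ -/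

import Mathlib

open MeasureTheory ProbabilityTheory Filter Topology
open scoped ENNReal NNReal

/-- Shannon entropy (in nats) `H(X) = -∑ₓ P(X = x) log P(X = x)` of a discrete random element `X`,
as an extended nonnegative number. Values of probability zero contribute `0`. -/
noncomputable def shannonEntropy {Ω α : Type*} [MeasurableSpace Ω] (P : Measure Ω) (X : Ω → α) :
    ℝ≥0∞ :=
  ∑' x : α, ENNReal.ofReal (Real.negMulLog (P.real (X ⁻¹' {x})))

/-- `h` is the entropy rate of the process `Y 0, Y 1, …`: the joint entropies of the first `n`
variables, divided by `n`, converge to `h`. -/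
def HasEntropyRate {Ω : Type*} [MeasurableSpace Ω] (P : Measure Ω) (Y : ℕ → Ω → ℝ) (h : ℝ≥0∞) :
    Prop :=
  Tendsto (fun n : ℕ => shannonEntropy P (fun ω (i : Fin n) => Y i ω) / (n : ℝ≥0∞)) atTop (𝓝 h)

/-- (Strict) stationarity: all finite-dimensional distributions are invariant under time shifts. -/
def IsStationaryProcess {Ω : Type*} [MeasurableSpace Ω] (P : Measure Ω) (Y : ℕ → Ω → ℝ) : Prop :=
  ∀ (n : ℕ) (t : Fin n → ℕ) (k : ℕ),
    IdentDistrib (fun ω (i : Fin n) => Y (t i + k) ω) (fun ω (i : Fin n) => Y (t i) ω) P P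

/-- The covariance function `R(k) = E[(Y_{m+k} - μ)(Y_m - μ)]`, `k ∈ ℤ`, of a process indexed by
`ℕ`, evaluated at the first time `m = max(-k, 0)` for which both `m` and `m + k` are `≥ 0`.
(For a stationary process the choice of `m` is immaterial.) -/
noncomputable def covFun {Ω : Type*} [MeasurableSpace Ω] (P : Measure Ω) (Y : ℕ → Ω → ℝ)
    (k : ℤ) : ℝ :=
  covariance (Y k.toNat) (Y (-k).toNat) P

/-- `Φ` is the power spectral density function of the finite-variance process `Y`: the covariance
function is absolutely summable and `Φ(l) = ∑_{k ∈ ℤ} R(k) e^{i l k}` for every real `l`. -/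
structure IsPSD {Ω : Type*} [MeasurableSpace Ω] (P : Measure Ω) (Y : ℕ → Ω → ℝ) (Φ : ℝ → ℝ) :
    Prop where
  memLp : ∀ n, MemLp (Y n) 2 P
  summable : Summable (fun k : ℤ => |covFun P Y k|)
  hasSum : ∀ l : ℝ, HasSum
    (fun k : ℤ => (covFun P Y k : ℂ) * Complex.exp (Complex.I * (l : ℂ) * (k : ℂ))) (Φ l : ℂ)

/-! ### Shannon entropy of discrete random elements -/

/-! Add to a block `Y 0, …, Y (n-1)` independent noise uniform on a unit cube. Since the alphabet is
1-separated, cubes around distinct values are disjoint, so no information is lost, while each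
variance grows by 1/12. Entropy is then controlled by comparison with a Gaussian.

The argument is carried out without differential entropy. Gibbs' inequality
(`shannonEntropy_le_integral_neg_log`) is applied with q(x) the exponential of the average of log g
over the cube around x, g being a Gaussian density. By Jensen q(x) is at most the mass of g on that
cube, so q is a subprobability (`sum_exp_cubeAverageLogPDF_le_one`). The cross entropy is explicit:
if g has variances d_j along an orthonormal basis in which the block has variances v_j, it equals ∑
(log(2π d_j)/2 + (v_j + 1/12)/(2 d_j)) (`shannonEntropy_le_of_orthogonal`).

The comparison Gaussian need not have the true covariance, so neither determinants nor Szegő's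
theorem enter. The basis is the Hartley basis, a real form of the Fourier basis, with d_j = Φ(2πj/n)
+ 1/12. Each v_j is a Fejér mean of Φ at 2πj/n plus a sine sum; the sine sums cancel once weighted
by 1/d_j, because Φ is symmetric about π (`IsStationaryProcess.sum_variance_hartley`). Fejér means
converge uniformly to Φ, so the quadratic terms contribute 1/2 + o(1) per symbol, and the logarithms
form a Riemann sum of the stated integral. The rate itself exists by subadditivity and Fekete's
lemma. -/

theorem hasSum_measureReal_singleton_mul {α : Type*} [Countable α] [MeasurableSpace α]
    [MeasurableSingletonClass α] {μ : Measure α} {f : α → ℝ} (hf : Integrable f μ) :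
    HasSum (fun x => μ.real {x} * f x) (∫ x, f x ∂μ) := by
  rw [← Measure.sum_smul_dirac μ] at hf
  have h := hasSum_integral_measure hf
  rw [Measure.sum_smul_dirac μ] at h
  refine h.congr_fun fun x => ?_
  rw [integral_smul_measure, integral_dirac, measureReal_def, smul_eq_mul]

section Entropy

variable {Ω : Type*} [MeasurableSpace Ω] {P : Measure Ω}

theorem map_measureReal_singleton {α : Type*} [MeasurableSpace α] [MeasurableSingletonClass α]
    {X : Ω → α} (hX : Measurable X) (x : α) : (P.map X).real {x} = P.real (X ⁻¹' {x}) :=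
  map_measureReal_apply hX (measurableSet_singleton x)

theorem sum_measureReal_preimage_singleton_le_one [IsProbabilityMeasure P] {α : Type*}
    [MeasurableSpace α] [MeasurableSingletonClass α] {X : Ω → α} (hX : Measurable X)
    (F : Finset α) : ∑ x ∈ F, P.real (X ⁻¹' {x}) ≤ 1 := by
  have : IsProbabilityMeasure (P.map X) := Measure.isProbabilityMeasure_map hX.aemeasurable
  simp only [← map_measureReal_singleton hX, sum_measureReal_singleton]
  exact measureReal_le_one

/-- **Gibbs' inequality**: the entropy is at most the cross entropy relative to a
subprobability mass function `q`. -/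
theorem shannonEntropy_le_integral_neg_log [IsProbabilityMeasure P] {α : Type*} [Countable α]
    [MeasurableSpace α] [MeasurableSingletonClass α] {X : Ω → α} (hX : Measurable X) {q : α → ℝ}
    (hq : ∀ x, 0 ≤ q x) (hpos : ∀ x, 0 < P.real (X ⁻¹' {x}) → 0 < q x)
    (hsum : ∀ F : Finset α, ∑ x ∈ F, q x ≤ 1)
    (hint : Integrable (fun ω => Real.log (q (X ω))) P) :
    shannonEntropy P X ≤ ENNReal.ofReal (∫ ω, -Real.log (q (X ω)) ∂P) := by
  have hprob : IsProbabilityMeasure (P.map X) := Measure.isProbabilityMeasure_map hX.aemeasurable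
  have hqs : Summable q := summable_of_sum_le hq hsum
  have hq1 : ∑' x, q x ≤ 1 := hqs.tsum_le_of_sum_le hsum
  have hint' : Integrable (fun x => -Real.log (q x)) (P.map X) :=
    ((integrable_map_measure (f := X) (g := fun x => Real.log (q x))
      (measurable_of_countable _).aestronglyMeasurable hX.aemeasurable).2 hint).neg
  have hL := hasSum_measureReal_singleton_mul hint'
  have h1 : HasSum (fun x => (P.map X).real {x}) 1 := by
    simpa using hasSum_measureReal_singleton_mul (integrable_const (1 : ℝ) (μ := P.map X))
  rw [integral_map hX.aemeasurable (measurable_of_countable _).aestronglyMeasurable] at hL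
  simp only [map_measureReal_singleton hX] at hL h1
  -- This is log t ≤ t - 1 at t = q/p, multiplied by p. Summed over x, the extra q - p contributes
  -- at most 0.
  have key : ∀ x, Real.negMulLog (P.real (X ⁻¹' {x})) ≤
      P.real (X ⁻¹' {x}) * -Real.log (q x) + q x - P.real (X ⁻¹' {x}) := by
    intro x
    rcases (measureReal_nonneg : 0 ≤ P.real (X ⁻¹' {x})).eq_or_lt with h | h
    · simp [← h, hq x]
    · have hqx := hpos x h
      have := Real.log_le_sub_one_of_pos (div_pos hqx h)
      rw [Real.log_div hqx.ne' h.ne'] at this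
      have h2 := mul_le_mul_of_nonneg_left this h.le
      rw [mul_sub, mul_sub, mul_div_cancel₀ _ h.ne'] at h2
      rw [Real.negMulLog]
      linarith
  have hnn : ∀ x, 0 ≤ Real.negMulLog (P.real (X ⁻¹' {x})) := fun x =>
    Real.negMulLog_nonneg measureReal_nonneg measureReal_le_one
  have hR := (hL.add hqs.hasSum).sub h1
  have hS : Summable fun x => Real.negMulLog (P.real (X ⁻¹' {x})) :=
    Summable.of_nonneg_of_le hnn key hR.summable
  rw [shannonEntropy, ← ENNReal.ofReal_tsum_of_nonneg hnn hS]
  refine ENNReal.ofReal_le_ofReal ?_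
  have := hasSum_le key hS.hasSum hR
  linarith

theorem shannonEntropy_eq_lintegral [IsFiniteMeasure P] {α : Type*} [Countable α]
    [MeasurableSpace α] [MeasurableSingletonClass α] {X : Ω → α} (hX : Measurable X) :
    shannonEntropy P X = ∫⁻ ω, ENNReal.ofReal (-Real.log (P.real (X ⁻¹' {X ω}))) ∂P := by
  rw [← lintegral_map (f := fun x => ENNReal.ofReal (-Real.log (P.real (X ⁻¹' {x}))))
    (measurable_of_countable _) hX, lintegral_countable', shannonEntropy]
  refine tsum_congr fun x => ?_
  rw [Measure.map_apply hX (measurableSet_singleton x), Real.negMulLog, neg_mul_comm, mul_comm,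
    ENNReal.ofReal_mul' measureReal_nonneg, ofReal_measureReal]

theorem integrable_log_measureReal_preimage [IsProbabilityMeasure P] {α : Type*} [Countable α]
    [MeasurableSpace α] [MeasurableSingletonClass α] {X : Ω → α} (hX : Measurable X)
    (hfin : shannonEntropy P X ≠ ⊤) :
    Integrable (fun ω => Real.log (P.real (X ⁻¹' {X ω}))) P ∧
      ∫ ω, -Real.log (P.real (X ⁻¹' {X ω})) ∂P = (shannonEntropy P X).toReal := by
  have hm : Measurable fun ω => -Real.log (P.real (X ⁻¹' {X ω})) :=
    (measurable_of_countable fun x => -Real.log (P.real (X ⁻¹' {x}))).comp hX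
  have hnn : ∀ ω, 0 ≤ -Real.log (P.real (X ⁻¹' {X ω})) := fun ω =>
    neg_nonneg.2 (Real.log_nonpos measureReal_nonneg measureReal_le_one)
  rw [shannonEntropy_eq_lintegral hX] at hfin ⊢
  have hi : Integrable (fun ω => -Real.log (P.real (X ⁻¹' {X ω}))) P :=
    (lintegral_ofReal_ne_top_iff_integrable hm.aestronglyMeasurable (ae_of_all _ hnn)).1 hfin
  exact ⟨by simpa using hi.neg,
    integral_eq_lintegral_of_nonneg_ae (ae_of_all _ hnn) hm.aestronglyMeasurable⟩

/-- Subadditivity of entropy. -/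
theorem shannonEntropy_prodMk_le [IsProbabilityMeasure P] {α β : Type*} [Countable α] [Countable β]
    [MeasurableSpace α] [MeasurableSingletonClass α] [MeasurableSpace β]
    [MeasurableSingletonClass β] {X : Ω → α} {Z : Ω → β} (hX : Measurable X) (hZ : Measurable Z) :
    shannonEntropy P (fun ω => (X ω, Z ω)) ≤ shannonEntropy P X + shannonEntropy P Z := by
  by_cases hXf : shannonEntropy P X = ⊤
  · simp [hXf]
  by_cases hZf : shannonEntropy P Z = ⊤
  · simp [hZf]
  obtain ⟨iX, eX⟩ := integrable_log_measureReal_preimage hX hXf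
  obtain ⟨iZ, eZ⟩ := integrable_log_measureReal_preimage hZ hZf
  have hposX : ∀ a b, 0 < P.real ((fun ω => (X ω, Z ω)) ⁻¹' {(a, b)}) →
      0 < P.real (X ⁻¹' {a}) := fun a b h =>
    h.trans_le (measureReal_mono (fun ω hω => by simp_all))
  have hposZ : ∀ a b, 0 < P.real ((fun ω => (X ω, Z ω)) ⁻¹' {(a, b)}) →
      0 < P.real (Z ⁻¹' {b}) := fun a b h =>
    h.trans_le (measureReal_mono (fun ω hω => by simp_all))
  -- The logarithm of the product splits only where both factors are nonzero; almost surely the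
  -- observed pair is an atom of positive mass, hence so are its marginals.
  have hae : ∀ᵐ ω ∂P, Real.log (P.real (X ⁻¹' {X ω}) * P.real (Z ⁻¹' {Z ω})) =
      Real.log (P.real (X ⁻¹' {X ω})) + Real.log (P.real (Z ⁻¹' {Z ω})) := by
    have h0 : ∀ᵐ ω ∂P, ∀ x : α × β, P.real ((fun ω => (X ω, Z ω)) ⁻¹' {x}) = 0 →
        (X ω, Z ω) ≠ x := by
      rw [ae_all_iff]
      intro x
      by_cases hx : P.real ((fun ω => (X ω, Z ω)) ⁻¹' {x}) = 0
      · have := measure_eq_zero_iff_ae_notMem.1 ((measureReal_eq_zero_iff).1 hx)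
        filter_upwards [this] with ω hω _
        simpa using hω
      · exact ae_of_all _ fun ω h => absurd h hx
    filter_upwards [h0] with ω hω
    have hp : 0 < P.real ((fun ω => (X ω, Z ω)) ⁻¹' {(X ω, Z ω)}) :=
      lt_of_le_of_ne measureReal_nonneg fun h => hω _ h.symm rfl
    exact Real.log_mul (hposX _ _ hp).ne' (hposZ _ _ hp).ne'
  refine (shannonEntropy_le_integral_neg_log (hX.prodMk hZ)
    (q := fun x => P.real (X ⁻¹' {x.1}) * P.real (Z ⁻¹' {x.2}))
    (fun x => mul_nonneg measureReal_nonneg measureReal_nonneg)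
    (fun x hx => mul_pos (hposX _ _ hx) (hposZ _ _ hx)) ?_ ?_).trans ?_
  · intro F
    classical
    calc ∑ x ∈ F, P.real (X ⁻¹' {x.1}) * P.real (Z ⁻¹' {x.2})
        ≤ ∑ x ∈ F.image Prod.fst ×ˢ F.image Prod.snd,
            P.real (X ⁻¹' {x.1}) * P.real (Z ⁻¹' {x.2}) :=
          Finset.sum_le_sum_of_subset_of_nonneg Finset.subset_product
            fun _ _ _ => mul_nonneg measureReal_nonneg measureReal_nonneg
      _ = (∑ a ∈ F.image Prod.fst, P.real (X ⁻¹' {a})) *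
            ∑ b ∈ F.image Prod.snd, P.real (Z ⁻¹' {b}) := by
          rw [Finset.sum_product, Finset.sum_mul_sum]
      _ ≤ 1 := mul_le_one₀ (sum_measureReal_preimage_singleton_le_one hX _)
            (Finset.sum_nonneg fun _ _ => measureReal_nonneg)
            (sum_measureReal_preimage_singleton_le_one hZ _)
  · exact (iX.add iZ).congr (hae.mono fun ω h => h.symm)
  · rw [integral_congr_ae (hae.mono fun ω h => by rw [h, neg_add]),
      integral_add (f := fun ω => -Real.log (P.real (X ⁻¹' {X ω})))
      (g := fun ω => -Real.log (P.real (Z ⁻¹' {Z ω}))) iX.neg iZ.neg, eX,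
      eZ, ENNReal.ofReal_add ENNReal.toReal_nonneg ENNReal.toReal_nonneg, ENNReal.ofReal_toReal hXf,
      ENNReal.ofReal_toReal hZf]

/-- Values outside the range of `f` have probability zero and contribute nothing. This moves
entropies from the uncountable space of real tuples to tuples in the countable alphabet, where
Gibbs' inequality applies. -/
theorem shannonEntropy_congr_of_injective {α β : Type*} {X : Ω → β} {Z : Ω → α} {f : α → β}
    (hf : Function.Injective f) (h : ∀ᵐ ω ∂P, X ω = f (Z ω)) :
    shannonEntropy P X = shannonEntropy P Z := by
  rw [shannonEntropy, shannonEntropy, ← hf.tsum_eq]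
  · refine tsum_congr fun a => ?_
    congr 2
    refine measureReal_congr ?_
    filter_upwards [h] with ω hω
    simp only [eq_iff_iff]
    change X ω = f a ↔ Z ω = a
    rw [hω, hf.eq_iff]
  · intro b hb
    by_contra hr
    refine hb ?_
    have : P (X ⁻¹' {b}) = 0 := by
      refine measure_eq_zero_iff_ae_notMem.2 ?_
      filter_upwards [h] with ω hω hmem
      exact hr ⟨Z ω, hω ▸ hmem⟩
    simp [measureReal_def, this]

theorem ProbabilityTheory.IdentDistrib.shannonEntropy_eq {Ω' : Type*} [MeasurableSpace Ω']
    {P' : Measure Ω'} {α : Type*}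
    [MeasurableSpace α] [MeasurableSingletonClass α] {X : Ω → α} {X' : Ω' → α}
    (h : IdentDistrib X X' P P') : shannonEntropy P X = shannonEntropy P' X' := by
  refine tsum_congr fun x => ?_
  rw [measureReal_def, measureReal_def, h.measure_mem_eq (measurableSet_singleton x)]

end Entropy

/-! ### Existence of the entropy rate -/

theorem countable_of_pairwise_one_le_abs_sub {A : Set ℝ}
    (hA : A.Pairwise (fun x y => 1 ≤ |x - y|)) : Countable A := by
  -- Points with the same floor differ by less than 1, so the floor is injective on `A`.
  refine Function.Injective.countable (f := fun x : A => ⌊(x : ℝ)⌋) fun x y hxy => ?_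
  by_contra hne
  exact (hA x.2 y.2 (fun h => hne (Subtype.ext h))).not_gt
    (Int.abs_sub_lt_one_of_floor_eq_floor hxy)

section EntropyRate

variable {Ω : Type*} [MeasurableSpace Ω] {P : Measure Ω}

theorem exists_measurable_subtype_ae_eq [NeZero P] {A : Set ℝ} [Countable A] {X : Ω → ℝ}
    (hX : AEMeasurable X P) (hXA : ∀ᵐ ω ∂P, X ω ∈ A) :
    ∃ Z : Ω → A, Measurable Z ∧ ∀ᵐ ω ∂P, X ω = Z ω := by
  classical
  obtain ⟨ω₀, h₀⟩ := hXA.exists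
  have hAm : MeasurableSet A := (Set.countable_coe_iff.1 ‹_›).measurableSet
  have hg : Measurable fun x : ℝ => if h : x ∈ A then (⟨x, h⟩ : A) else ⟨X ω₀, h₀⟩ :=
    Measurable.dite (s := A) measurable_id measurable_const hAm
  refine ⟨fun ω => (fun x : ℝ => if h : x ∈ A then (⟨x, h⟩ : A) else ⟨X ω₀, h₀⟩) (hX.mk X ω),
    hg.comp hX.measurable_mk, ?_⟩
  filter_upwards [hXA, hX.ae_eq_mk] with ω h1 h2
  rw [h2] at h1
  simp [h1, h2]

theorem shannonEntropy_block_eq {A : Set ℝ} {ι : Type*} [Finite ι] {Y : ι → Ω → ℝ}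
    {Z : ι → Ω → A} (h : ∀ n, ∀ᵐ ω ∂P, Y n ω = Z n ω) :
    shannonEntropy P (fun ω i => Y i ω) = shannonEntropy P (fun ω i => Z i ω) :=
  shannonEntropy_congr_of_injective (f := fun z i => ((z i : A) : ℝ))
    (Function.Injective.comp_left Subtype.val_injective)
    ((ae_all_iff.2 h).mono fun _ hω => funext hω)

variable [IsProbabilityMeasure P] {Y : ℕ → Ω → ℝ}

theorem IsStationaryProcess.shannonEntropy_add_le {A : Set ℝ} [Countable A] {Z : ℕ → Ω → A}
    (hY : IsStationaryProcess P Y) (hZ : ∀ n, Measurable (Z n))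
    (hYZ : ∀ n, ∀ᵐ ω ∂P, Y n ω = Z n ω) (m n : ℕ) :
    shannonEntropy P (fun ω (i : Fin (m + n)) => Y i ω) ≤
      shannonEntropy P (fun ω (i : Fin m) => Y i ω) +
        shannonEntropy P (fun ω (i : Fin n) => Y i ω) := by
  have h1 : shannonEntropy P (fun ω (i : Fin (m + n)) => Y i ω) =
      shannonEntropy P (fun ω => ((fun i : Fin m => Z i ω), fun i : Fin n => Z (i + m) ω)) := by
    rw [shannonEntropy_block_eq (fun i : Fin (m + n) => hYZ i)]
    refine shannonEntropy_congr_of_injective (f := (Fin.appendEquiv m n : _ ≃ (Fin (m + n) → A)))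
      (Fin.appendEquiv m n).injective (ae_of_all _ fun ω => ?_)
    funext i
    refine Fin.addCases (fun i => ?_) (fun i => ?_) i
    · simp [Fin.appendEquiv]
    · simp [Fin.appendEquiv, add_comm]
  rw [h1, shannonEntropy_block_eq (fun i : Fin m => hYZ i), ← (hY n (fun i => i) m).shannonEntropy_eq,
    shannonEntropy_block_eq (fun i : Fin n => hYZ (i + m))]
  exact shannonEntropy_prodMk_le (measurable_pi_lambda _ fun i => hZ _)
    (measurable_pi_lambda _ fun i => hZ _)

/-- Fekete's lemma: stationarity makes the block entropy subadditive in the block length. -/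
theorem IsStationaryProcess.exists_hasEntropyRate {A : Set ℝ} [Countable A] {Z : ℕ → Ω → A}
    (hY : IsStationaryProcess P Y) (hZ : ∀ n, Measurable (Z n))
    (hYZ : ∀ n, ∀ᵐ ω ∂P, Y n ω = Z n ω)
    (hfin : ∀ n, shannonEntropy P (fun ω (i : Fin n) => Y i ω) ≠ ⊤) :
    ∃ h : ℝ≥0, HasEntropyRate P Y h ∧
      Tendsto (fun n : ℕ => (shannonEntropy P (fun ω (i : Fin n) => Y i ω)).toReal / n) atTop
        (𝓝 (h : ℝ)) := by
  have hsub : Subadditive fun n : ℕ => (shannonEntropy P (fun ω (i : Fin n) => Y i ω)).toReal :=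
    fun m n => by
      rw [← ENNReal.toReal_add (hfin m) (hfin n)]
      exact ENNReal.toReal_mono (ENNReal.add_ne_top.2 ⟨hfin m, hfin n⟩)
        (hY.shannonEntropy_add_le hZ hYZ m n)
  have hnn : ∀ n : ℕ, 0 ≤ (shannonEntropy P (fun ω (i : Fin n) => Y i ω)).toReal / n :=
    fun n => by positivity
  have hlim := hsub.tendsto_lim ⟨0, by rintro _ ⟨n, rfl⟩; exact hnn n⟩
  refine ⟨⟨hsub.lim, ge_of_tendsto' hlim hnn⟩, ?_, hlim⟩
  refine (ENNReal.tendsto_ofReal hlim).congr' ?_ |>.trans (le_of_eq ?_)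
  · filter_upwards [eventually_gt_atTop 0] with n hn
    rw [ENNReal.ofReal_div_of_pos (by exact_mod_cast hn), ENNReal.ofReal_toReal (hfin n),
      ENNReal.ofReal_natCast]
  · rw [ENNReal.ofReal_eq_coe_nnreal (ge_of_tendsto' hlim hnn)]
    rfl

end EntropyRate

/-! ### Comparison with a Gaussian density smoothed over unit cubes -/

/-- The uniform distribution on the unit interval centred at `0`. -/
noncomputable abbrev centeredUniform : Measure ℝ := volume.restrict (Set.Ico (-1 / 2) (1 / 2))

instance : IsProbabilityMeasure centeredUniform :=
  ⟨by rw [Measure.restrict_apply_univ, Real.volume_Ico]; norm_num⟩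

theorem memLp_mul_centeredUniform (c : ℝ) : MemLp (fun u : ℝ => c * u) 2 centeredUniform := by
  refine (memLp_top_of_bound (by fun_prop) (|c| * (1 / 2)) ?_).mono_exponent le_top
  refine (ae_restrict_mem measurableSet_Ico).mono fun u hu => ?_
  rw [Real.norm_eq_abs, abs_mul]
  exact mul_le_mul_of_nonneg_left (abs_le.2 ⟨by linarith [hu.1], hu.2.le⟩) (abs_nonneg _)

theorem integral_mul_centeredUniform (c : ℝ) : ∫ u, c * u ∂centeredUniform = 0 := by
  rw [integral_const_mul, integral_Ico_eq_integral_Ioc,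
    ← intervalIntegral.integral_of_le (by norm_num), integral_id]
  norm_num

theorem variance_mul_centeredUniform (c : ℝ) :
    Var[fun u => c * u; centeredUniform] = c ^ 2 / 12 := by
  rw [variance_of_integral_eq_zero (by fun_prop) (integral_mul_centeredUniform c)]
  simp_rw [mul_pow]
  rw [integral_const_mul, integral_Ico_eq_integral_Ioc,
    ← intervalIntegral.integral_of_le (by norm_num), integral_pow]
  norm_num
  ring

section Cube

variable {ι : Type*} [Fintype ι]

/-- The uniform distribution on the unit cube centred at `0`. -/
noncomputable abbrev centeredUniformPi (ι : Type*) [Fintype ι] : Measure (ι → ℝ) :=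
  Measure.pi fun _ : ι => centeredUniform

theorem memLp_sum_mul_centeredUniformPi (c : ι → ℝ) :
    MemLp (fun u : ι → ℝ => ∑ i, c i * u i) 2 (centeredUniformPi ι) :=
  memLp_finsetSum _ fun i _ => (memLp_mul_centeredUniform (c i)).comp_measurePreserving
    (measurePreserving_eval (fun _ : ι => centeredUniform) i)

theorem integral_sum_mul_centeredUniformPi (c : ι → ℝ) :
    ∫ u, ∑ i, c i * u i ∂centeredUniformPi ι = 0 := by
  rw [integral_finsetSum]
  · refine Finset.sum_eq_zero fun i _ => ?_
    have := (measurePreserving_eval (fun _ : ι => centeredUniform) i)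
    have h2 := integral_map (μ := centeredUniformPi ι) (φ := Function.eval i)
      this.measurable.aemeasurable (f := fun u => c i * u) (by fun_prop)
    rw [this.map_eq, integral_mul_centeredUniform] at h2
    exact h2.symm
  · intro i _
    exact ((memLp_mul_centeredUniform (c i)).comp_measurePreserving
      (measurePreserving_eval (fun _ : ι => centeredUniform) i)).integrable one_le_two

theorem integrable_add_sum_sq_centeredUniformPi (a : ℝ) (c : ι → ℝ) :
    Integrable (fun u : ι → ℝ => (a + ∑ i, c i * u i) ^ 2) (centeredUniformPi ι) :=
  ((memLp_const a).add (memLp_sum_mul_centeredUniformPi c)).integrable_sq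

theorem integral_add_sum_sq_centeredUniformPi (a : ℝ) (c : ι → ℝ) :
    ∫ u, (a + ∑ i, c i * u i) ^ 2 ∂centeredUniformPi ι = a ^ 2 + (∑ i, c i ^ 2) / 12 := by
  have hv : Var[fun u : ι → ℝ => ∑ i, c i * u i; centeredUniformPi ι] = (∑ i, c i ^ 2) / 12 := by
    have h := variance_sum_pi (μ := fun _ : ι => centeredUniform) (X := fun i u => c i * u)
      fun i => memLp_mul_centeredUniform (c i)
    simp only [variance_mul_centeredUniform, ← Finset.sum_div] at h
    rw [← h]
    congr 1
    ext u
    simp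
  rw [variance_of_integral_eq_zero (memLp_sum_mul_centeredUniformPi c).aemeasurable
    (integral_sum_mul_centeredUniformPi c)] at hv
  have hi := (memLp_sum_mul_centeredUniformPi c).integrable one_le_two
  have hs := (memLp_sum_mul_centeredUniformPi c).integrable_sq
  simp_rw [add_sq]
  have hi' : Integrable (fun u : ι → ℝ => a ^ 2 + 2 * a * ∑ i, c i * u i) (centeredUniformPi ι) :=
    (integrable_const _).add (hi.const_mul _)
  rw [integral_add hi' hs, integral_add (integrable_const _) (hi.const_mul _), integral_const_mul,
    integral_sum_mul_centeredUniformPi, hv]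
  simp

theorem Matrix.measurePreserving_toLin' [DecidableEq ι] {M : Matrix ι ι ℝ}
    (hM : M * M.transpose = 1) :
    MeasurePreserving (Matrix.toLin' M) (volume : Measure (ι → ℝ)) volume := by
  have hdet : M.det * M.det = 1 := by
    simpa [Matrix.det_mul] using congrArg Matrix.det hM
  have h0 : M.det ≠ 0 := fun h => by simp [h] at hdet
  refine ⟨(LinearMap.continuous_of_finiteDimensional _).measurable, ?_⟩
  rw [Real.map_matrix_volume_pi_eq_smul_volume_pi h0]
  have : |M.det⁻¹| = 1 := by
    rw [abs_inv, inv_eq_one]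
    rcases mul_self_eq_one_iff.1 hdet with h | h <;> simp [h]
  simp [this]

/-- The Gaussian density on `ι → ℝ` whose coordinates along the rows of `M` are independent
with means `m` and variances `d`. -/
noncomputable def rotatedGaussianPDF (M : Matrix ι ι ℝ) (m : ι → ℝ) (d : ι → ℝ≥0) (x : ι → ℝ) : ℝ :=
  ∏ j, gaussianPDFReal (m j) (d j) (M.mulVec x j)

variable {M : Matrix ι ι ℝ} {m : ι → ℝ} {d : ι → ℝ≥0}

theorem rotatedGaussianPDF_pos (hd : ∀ j, d j ≠ 0) (x : ι → ℝ) : 0 < rotatedGaussianPDF M m d x :=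
  Finset.prod_pos fun j _ => gaussianPDFReal_pos _ _ _ (hd j)

theorem integrable_rotatedGaussianPDF [DecidableEq ι] (hM : M * M.transpose = 1) :
    Integrable (rotatedGaussianPDF M m d) volume :=
  (Matrix.measurePreserving_toLin' hM).integrable_comp_of_integrable
    (Integrable.fintype_prod fun j => integrable_gaussianPDFReal (m j) (d j))

theorem integral_rotatedGaussianPDF [DecidableEq ι] (hM : M * M.transpose = 1)
    (hd : ∀ j, d j ≠ 0) : ∫ x, rotatedGaussianPDF M m d x = 1 := by
  have h := Matrix.measurePreserving_toLin' hM
  have hG : Integrable (fun y : ι → ℝ => ∏ j, gaussianPDFReal (m j) (d j) (y j)) volume :=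
    Integrable.fintype_prod fun j => integrable_gaussianPDFReal (m j) (d j)
  have h2 := integral_map h.measurable.aemeasurable (h.map_eq.symm ▸ hG.aestronglyMeasurable)
  rw [h.map_eq, integral_fintype_prod_volume_eq_prod] at h2
  simp only [integral_gaussianPDFReal_eq_one _ (hd _), Finset.prod_const_one] at h2
  exact h2.symm

theorem log_gaussianPDFReal (μ : ℝ) {v : ℝ≥0} (hv : v ≠ 0) (x : ℝ) :
    Real.log (gaussianPDFReal μ v x) =
      -(Real.log (2 * Real.pi * v) / 2) - (x - μ) ^ 2 / (2 * v) := by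
  have hv' : (0 : ℝ) < v := by positivity
  have h : 0 < 2 * Real.pi * (v : ℝ) := by positivity
  rw [gaussianPDFReal_def, Real.log_mul (by positivity) (Real.exp_ne_zero _), Real.log_exp,
    Real.log_inv, Real.log_sqrt h.le]
  ring

theorem log_rotatedGaussianPDF (hd : ∀ j, d j ≠ 0) (x : ι → ℝ) :
    Real.log (rotatedGaussianPDF M m d x) =
      ∑ j, (-(Real.log (2 * Real.pi * d j) / 2) - (M.mulVec x j - m j) ^ 2 / (2 * d j)) := by
  rw [rotatedGaussianPDF, Real.log_prod fun j _ => (gaussianPDFReal_pos _ _ _ (hd j)).ne']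
  exact Finset.sum_congr rfl fun j _ => log_gaussianPDFReal _ (hd j) _

/-- The average of the logarithm of the rotated Gaussian density over the unit cube around `x`. -/
noncomputable def cubeAverageLogPDF (M : Matrix ι ι ℝ) (m : ι → ℝ) (d : ι → ℝ≥0) (x : ι → ℝ) : ℝ :=
  ∑ j, (-(Real.log (2 * Real.pi * d j) / 2) -
    ((M.mulVec x j - m j) ^ 2 + 1 / 12) / (2 * d j))

/-- Jensen's inequality for `exp` over the unit cube. The 1/12 in `cubeAverageLogPDF` is the
variance of a uniform point of the cube along a row of `M`, which has unit length. -/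
theorem exp_cubeAverageLogPDF_le [DecidableEq ι] (hM : M * M.transpose = 1) (hd : ∀ j, d j ≠ 0)
    (x : ι → ℝ) :
    Real.exp (cubeAverageLogPDF M m d x) ≤
      ∫ u, rotatedGaussianPDF M m d (x + u) ∂centeredUniformPi ι := by
  have hrow : ∀ j, ∑ i, M j i ^ 2 = 1 := fun j => by
    have := congrFun (congrFun hM j) j
    simpa [Matrix.mul_apply, sq] using this
  have hlog : ∀ u, Real.log (rotatedGaussianPDF M m d (x + u)) =
      ∑ j, (-(Real.log (2 * Real.pi * d j) / 2) -
        ((M.mulVec x j - m j) + ∑ i, M j i * u i) ^ 2 / (2 * d j)) := fun u => by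
    rw [log_rotatedGaussianPDF hd]
    refine Finset.sum_congr rfl fun j _ => ?_
    rw [Matrix.mulVec_add, Pi.add_apply, add_sub_right_comm]
    rfl
  have hint : ∀ j, Integrable (fun u : ι → ℝ => -(Real.log (2 * Real.pi * d j) / 2) -
        ((M.mulVec x j - m j) + ∑ i, M j i * u i) ^ 2 / (2 * d j)) (centeredUniformPi ι) := fun j =>
    (integrable_const _).sub ((integrable_add_sum_sq_centeredUniformPi _ _).div_const _)
  have hL : ∫ u, Real.log (rotatedGaussianPDF M m d (x + u)) ∂centeredUniformPi ι =
      cubeAverageLogPDF M m d x := by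
    simp_rw [hlog]
    rw [integral_finsetSum _ fun j _ => hint j]
    refine Finset.sum_congr rfl fun j _ => ?_
    rw [integral_sub (integrable_const _)
      ((integrable_add_sum_sq_centeredUniformPi _ _).div_const _), integral_div,
      integral_add_sum_sq_centeredUniformPi, hrow]
    simp
  have hexp : ∀ u, Real.exp (Real.log (rotatedGaussianPDF M m d (x + u))) =
      rotatedGaussianPDF M m d (x + u) := fun u => Real.exp_log (rotatedGaussianPDF_pos hd _)
  have hgi : Integrable (fun u => rotatedGaussianPDF M m d (x + u)) (centeredUniformPi ι) := by
    rw [centeredUniformPi, ← Measure.restrict_pi_pi]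
    exact ((integrable_rotatedGaussianPDF hM).comp_add_left x).restrict
  rw [← hL]
  refine (convexOn_exp.map_integral_le Real.continuous_exp.continuousOn isClosed_univ
    (ae_of_all _ fun _ => Set.mem_univ _) ?_ (hgi.congr (ae_of_all _ fun u => (hexp u).symm))).trans
    (le_of_eq (integral_congr_ae (ae_of_all _ hexp)))
  simp_rw [hlog]
  exact integrable_finsetSum _ fun j _ => hint j

/-- Half-open unit cubes centred at points at sup-distance at least 1 are disjoint, so their
Gaussian masses add up to at most 1. -/
theorem sum_exp_cubeAverageLogPDF_le_one [DecidableEq ι] (hM : M * M.transpose = 1)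
    (hd : ∀ j, d j ≠ 0) (F : Finset (ι → ℝ))
    (hF : (F : Set (ι → ℝ)).Pairwise fun x y => ∃ i, 1 ≤ |x i - y i|) :
    ∑ x ∈ F, Real.exp (cubeAverageLogPDF M m d x) ≤ 1 := by
  set C : Set (ι → ℝ) := Set.univ.pi fun _ => Set.Ico (-1 / 2) (1 / 2) with hC
  have hCm : MeasurableSet C := MeasurableSet.univ_pi fun _ => measurableSet_Ico
  let D : (ι → ℝ) → Set (ι → ℝ) := fun x => (fun y => y - x) ⁻¹' C
  have hDm : ∀ x, MeasurableSet (D x) := fun x => (measurable_id.sub_const x) hCm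
  have hD : ∀ x, ∫ u, rotatedGaussianPDF M m d (x + u) ∂centeredUniformPi ι =
      ∫ y in D x, rotatedGaussianPDF M m d y := fun x => by
    rw [centeredUniformPi, ← Measure.restrict_pi_pi, ← hC,
      ← (measurePreserving_add_left volume x).setIntegral_preimage_emb
        (measurableEmbedding_addLeft x)]
    congr 2
    ext u
    simp [D]
  have hdisj : (F : Set (ι → ℝ)).PairwiseDisjoint D := by
    intro x hx y hy hxy
    obtain ⟨i, hi⟩ := hF hx hy hxy
    refine Set.disjoint_left.2 fun z hzx hzy => hi.not_gt ?_
    have h1 := hzx i (Set.mem_univ i)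
    have h2 := hzy i (Set.mem_univ i)
    simp only [Pi.sub_apply, Set.mem_Ico] at h1 h2
    rw [abs_lt]
    constructor <;> linarith
  have hI := integrable_rotatedGaussianPDF (m := m) (d := d) hM
  calc ∑ x ∈ F, Real.exp (cubeAverageLogPDF M m d x)
      ≤ ∑ x ∈ F, ∫ y in D x, rotatedGaussianPDF M m d y :=
        Finset.sum_le_sum fun x _ => (exp_cubeAverageLogPDF_le hM hd x).trans_eq (hD x)
    _ = ∫ y in ⋃ x ∈ F, D x, rotatedGaussianPDF M m d y :=
        (integral_biUnion_finset F (fun x _ => hDm x) hdisj fun x _ => hI.integrableOn).symm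
    _ ≤ ∫ y, rotatedGaussianPDF M m d y :=
        setIntegral_le_integral hI (ae_of_all _ fun y => (rotatedGaussianPDF_pos hd y).le)
    _ = 1 := integral_rotatedGaussianPDF hM hd

/-- **Maximum entropy bound** for separated alphabets: the entropy of `Z` is bounded by the
cross entropy of `Z`, smoothed over unit cubes, relative to a Gaussian density with variances `d`
along the rows of an orthogonal matrix `M`. -/
theorem shannonEntropy_le_of_orthogonal {Ω : Type*} [MeasurableSpace Ω] {P : Measure Ω}
    [IsProbabilityMeasure P] [DecidableEq ι] {A : Set ℝ} [Countable A]
    (hA : A.Pairwise (fun x y => 1 ≤ |x - y|)) {Z : ι → Ω → A} (hZ : ∀ i, Measurable (Z i))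
    (hL2 : ∀ i, MemLp (fun ω => (Z i ω : ℝ)) 2 P) (hM : M * M.transpose = 1)
    (hd : ∀ j, d j ≠ 0) :
    shannonEntropy P (fun ω i => Z i ω) ≠ ⊤ ∧
    (shannonEntropy P (fun ω i => Z i ω)).toReal ≤
      ∑ j, (Real.log (2 * Real.pi * d j) / 2 +
        (Var[fun ω => ∑ i, M j i * (Z i ω : ℝ); P] + 1 / 12) / (2 * d j)) := by
  classical
  let e : (ι → A) → (ι → ℝ) := fun z i => z i
  have he : Function.Injective e := Function.Injective.comp_left Subtype.val_injective
  let S : ι → Ω → ℝ := fun j ω => ∑ i, M j i * (Z i ω : ℝ)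
  let m : ι → ℝ := fun j => ∫ ω, S j ω ∂P
  have hS : ∀ j, MemLp (S j) 2 P := fun j => memLp_finsetSum _ fun i _ => (hL2 i).const_mul _
  have hsq : ∀ j, Integrable (fun ω => (S j ω - m j) ^ 2) P := fun j =>
    ((hS j).sub (memLp_const (m j))).integrable_sq
  have hlog : ∀ ω, cubeAverageLogPDF M m d (e fun i => Z i ω) =
      ∑ j, (-(Real.log (2 * Real.pi * d j) / 2) - ((S j ω - m j) ^ 2 + 1 / 12) / (2 * d j)) :=
    fun ω => rfl
  have hint : ∀ j, Integrable (fun ω => -(Real.log (2 * Real.pi * d j) / 2) -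
      ((S j ω - m j) ^ 2 + 1 / 12) / (2 * d j)) P := fun j =>
    (integrable_const _).sub (((hsq j).add (integrable_const _)).div_const _)
  have hsum : ∀ F : Finset (ι → A), ∑ z ∈ F, Real.exp (cubeAverageLogPDF M m d (e z)) ≤ 1 := by
    intro F
    rw [← Finset.sum_image (f := fun x => Real.exp (cubeAverageLogPDF M m d x)) he.injOn]
    refine sum_exp_cubeAverageLogPDF_le_one hM hd _ ?_
    intro x hx y hy hxy
    rw [Finset.coe_image] at hx hy
    obtain ⟨a, -, rfl⟩ := hx
    obtain ⟨b, -, rfl⟩ := hy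
    obtain ⟨i, hi⟩ := Function.ne_iff.1 hxy
    exact ⟨i, hA (a i).2 (b i).2 hi⟩
  have hG := shannonEntropy_le_integral_neg_log (P := P) (X := fun ω i => Z i ω)
    (measurable_pi_lambda _ hZ) (q := fun z => Real.exp (cubeAverageLogPDF M m d (e z)))
    (fun _ => (Real.exp_pos _).le) (fun _ _ => Real.exp_pos _) hsum (by
      simp only [Real.log_exp, hlog]
      exact integrable_finsetSum _ fun j _ => hint j)
  refine ⟨ne_top_of_le_ne_top ENNReal.ofReal_ne_top hG, ?_⟩
  refine (ENNReal.toReal_le_of_le_ofReal (integral_nonneg fun ω => ?_) hG).trans_eq ?_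
  -- A one-element sum already gives q ≤ 1, so the cross entropy is nonnegative.
  · refine neg_nonneg.2 (Real.log_nonpos (Real.exp_pos _).le ?_)
    simpa using hsum {fun i => Z i ω}
  · simp only [Real.log_exp, hlog]
    rw [integral_neg, integral_finsetSum _ fun j _ => hint j, ← Finset.sum_neg_distrib]
    refine Finset.sum_congr rfl fun j _ => ?_
    have hc : Integrable (fun ω => (S j ω - m j) ^ 2 + 1 / 12) P :=
      (hsq j).add (integrable_const _)
    rw [integral_sub (integrable_const _) (hc.div_const _), integral_div,
      integral_add (hsq j) (integrable_const _), ← variance_eq_integral (hS j).aemeasurable]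
    simp only [integral_const, probReal_univ, smul_eq_mul, one_mul, S]
    ring

end Cube

/-! ### The Hartley matrix -/

theorem sum_exp_two_pi_mul_div {n : ℕ} (hn : 0 < n) (a : ℤ) :
    ∑ k : Fin n, Complex.exp (((2 * Real.pi * a * k / n : ℝ) : ℂ) * Complex.I) =
      if (n : ℤ) ∣ a then (n : ℂ) else 0 := by
  have hn0 : (n : ℂ) ≠ 0 := by exact_mod_cast hn.ne'
  set z : ℂ := Complex.exp (2 * Real.pi * Complex.I * (a / n)) with hz
  have hzk : ∀ k : ℕ, Complex.exp (((2 * Real.pi * a * k / n : ℝ) : ℂ) * Complex.I) = z ^ k := by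
    intro k
    rw [hz, ← Complex.exp_nat_mul]
    congr 1
    push_cast
    ring
  simp only [hzk]
  rw [Fin.sum_univ_eq_sum_range (fun k => z ^ k) n]
  have hz1 : z = 1 ↔ (n : ℤ) ∣ a := by
    rw [hz, Complex.exp_eq_one_iff]
    constructor
    · rintro ⟨m, hm⟩
      refine ⟨m, ?_⟩
      have h2 : (2 * Real.pi * Complex.I : ℂ) ≠ 0 := Complex.two_pi_I_ne_zero
      have h3 : (a : ℂ) / n = m := mul_left_cancel₀ h2 (by rw [hm]; ring)
      rw [div_eq_iff hn0] at h3
      have h4 : (a : ℂ) = ((n * m : ℤ) : ℂ) := by rw [h3]; push_cast; ring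
      exact_mod_cast h4
    · rintro ⟨m, rfl⟩
      refine ⟨m, ?_⟩
      push_cast
      field_simp
  have hzn : z ^ n = 1 := by
    rw [hz, ← Complex.exp_nat_mul, Complex.exp_eq_one_iff]
    exact ⟨a, by field_simp⟩
  split_ifs with h
  · simp [hz1.2 h]
  · rw [geom_sum_eq (mt hz1.1 h), hzn]
    simp

theorem sum_cos_two_pi_mul_div {n : ℕ} (hn : 0 < n) (a : ℤ) :
    ∑ k : Fin n, Real.cos (2 * Real.pi * a * k / n) = if (n : ℤ) ∣ a then (n : ℝ) else 0 := by
  have h := congrArg Complex.re (sum_exp_two_pi_mul_div hn a)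
  simp only [Complex.re_sum, Complex.exp_ofReal_mul_I_re] at h
  rw [h]
  split_ifs <;> simp

theorem sum_sin_two_pi_mul_div {n : ℕ} (hn : 0 < n) (a : ℤ) :
    ∑ k : Fin n, Real.sin (2 * Real.pi * a * k / n) = 0 := by
  have h := congrArg Complex.im (sum_exp_two_pi_mul_div hn a)
  simp only [Complex.im_sum, Complex.exp_ofReal_mul_I_im] at h
  rw [h]
  split_ifs <;> simp

/-- The matrix of the discrete Hartley transform, a real form of the discrete Fourier transform. -/
noncomputable def hartleyMatrix (n : ℕ) : Matrix (Fin n) (Fin n) ℝ := fun j k =>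
  (Real.cos (2 * Real.pi * j / n * k) + Real.sin (2 * Real.pi * j / n * k)) / √n

theorem hartleyMatrix_mul_transpose {n : ℕ} (hn : 0 < n) :
    hartleyMatrix n * (hartleyMatrix n).transpose = 1 := by
  have hn0 : (n : ℝ) ≠ 0 := by exact_mod_cast hn.ne'
  have hs : √(n : ℝ) * √n = n := Real.mul_self_sqrt (Nat.cast_nonneg n)
  ext j l
  -- (cos a + sin a)(cos b + sin b) = cos(a - b) + sin(a + b).
  have hterm : ∀ k : Fin n, hartleyMatrix n j k * hartleyMatrix n l k =
      (Real.cos (2 * Real.pi * ((j : ℤ) - (l : ℤ) : ℤ) * k / n) +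
        Real.sin (2 * Real.pi * ((j : ℤ) + (l : ℤ) : ℤ) * k / n)) / n := by
    intro k
    rw [hartleyMatrix, hartleyMatrix, div_mul_div_comm, hs]
    congr 1
    rw [show 2 * Real.pi * ((((j : ℤ) - (l : ℤ) : ℤ)) : ℝ) * k / n =
        2 * Real.pi * j / n * k - 2 * Real.pi * l / n * k by push_cast; ring,
      show 2 * Real.pi * ((((j : ℤ) + (l : ℤ) : ℤ)) : ℝ) * k / n =
        2 * Real.pi * j / n * k + 2 * Real.pi * l / n * k by push_cast; ring,
      Real.cos_sub, Real.sin_add]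
    ring
  rw [Matrix.mul_apply]
  simp only [Matrix.transpose_apply, hterm]
  rw [← Finset.sum_div, Finset.sum_add_distrib, sum_cos_two_pi_mul_div hn,
    sum_sin_two_pi_mul_div hn, add_zero, Matrix.one_apply]
  have hiff : (n : ℤ) ∣ (j : ℤ) - (l : ℤ) ↔ j = l := by
    constructor
    · intro h
      have := Int.eq_zero_of_abs_lt_dvd h (by rw [abs_lt]; constructor <;> omega)
      ext
      omega
    · rintro rfl
      simp
  simp only [hiff]
  split_ifs <;> simp [hn0]

/-- The reflection j ↦ n - j preserves the weight and flips the sign of the sine. The term j = n is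
zero and is adjoined so that the index range becomes symmetric. -/
theorem sum_mul_sin_eq_zero_of_symm {n : ℕ} (hn : 0 < n) {w : ℝ → ℝ}
    (hw : ∀ l, w (2 * Real.pi - l) = w l) (s : ℕ) :
    ∑ j : Fin n, w (2 * Real.pi * j / n) * Real.sin (2 * Real.pi * j / n * s) = 0 := by
  have hn0 : (n : ℝ) ≠ 0 := by exact_mod_cast hn.ne'
  set F : ℕ → ℝ := fun j => w (2 * Real.pi * j / n) * Real.sin (2 * Real.pi * j / n * s) with hF
  rw [Fin.sum_univ_eq_sum_range F n]
  have hFn : F n = 0 := by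
    have : 2 * Real.pi * n / n * s = (s : ℕ) * (2 * Real.pi) := by field_simp
    have h0 := Real.sin_nat_mul_two_pi_sub 0 s
    rw [sub_zero, Real.sin_zero, neg_zero] at h0
    simp only [hF, this, h0, mul_zero]
  have hrefl : ∀ j ∈ Finset.range (n + 1), F (n + 1 - 1 - j) = -F j := by
    intro j hj
    have hj' : j ≤ n := Nat.lt_succ_iff.1 (Finset.mem_range.1 hj)
    have h1 : 2 * Real.pi * ((n - j : ℕ) : ℝ) / n = 2 * Real.pi - 2 * Real.pi * j / n := by
      rw [Nat.cast_sub hj']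
      field_simp
    simp only [hF, Nat.add_sub_cancel, h1, hw]
    rw [sub_mul, mul_comm (2 * Real.pi) (s : ℝ), Real.sin_nat_mul_two_pi_sub]
    ring
  have h := Finset.sum_range_reflect F (n + 1)
  rw [Finset.sum_congr rfl hrefl, Finset.sum_neg_distrib, Finset.sum_range_succ, hFn] at h
  linarith

/-! ### Cesàro means of Fourier series -/

/-- The tail `∑_{|m| > N} |r m|` of an absolutely convergent two-sided series. -/
noncomputable def absTail (r : ℤ → ℝ) (N : ℕ) : ℝ :=
  ∑' m, |r m| - ∑ m ∈ Finset.Icc (-(N : ℤ)) N, |r m|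

section Fejer

variable {r : ℤ → ℝ}

theorem tendsto_absTail (hr : Summable fun m => |r m|) : Tendsto (absTail r) atTop (𝓝 0) := by
  have hmono : Tendsto (fun N : ℕ => Finset.Icc (-(N : ℤ)) N) atTop atTop := by
    refine tendsto_atTop_finset_of_monotone (fun a b hab => Finset.Icc_subset_Icc ?_ ?_) fun x => ?_
    · simpa using hab
    · simpa using hab
    · refine ⟨x.natAbs, Finset.mem_Icc.2 ?_⟩
      omega
  have h := (hr.hasSum.comp hmono).const_sub (∑' m, |r m|)
  rw [sub_self] at h
  exact h

theorem absTail_nonneg (hr : Summable fun m => |r m|) (N : ℕ) : 0 ≤ absTail r N :=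
  sub_nonneg.2 (hr.sum_le_tsum _ fun _ _ => abs_nonneg _)

theorem abs_tsum_sub_sum_le_absTail (hr : Summable fun m => |r m|) {f : ℤ → ℝ}
    (hf : ∀ m, |f m| ≤ |r m|) {S : Finset ℤ} {N : ℕ}
    (hS : Finset.Icc (-(N : ℤ)) N ⊆ S) : |∑' m, f m - ∑ m ∈ S, f m| ≤ absTail r N := by
  have hfs : Summable f := Summable.of_norm_bounded hr hf
  rw [← hfs.sum_add_tsum_compl (s := S), add_sub_cancel_left]
  have hrc : Summable fun x : ↑((S : Set ℤ)ᶜ) => |r x| := hr.subtype _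
  have h1 : |∑' x : ↑((S : Set ℤ)ᶜ), f x| ≤ ∑' x : ↑((S : Set ℤ)ᶜ), |r x| :=
    tsum_of_norm_bounded (f := fun x : ↑((S : Set ℤ)ᶜ) => f x) hrc.hasSum fun x => hf x
  have h2 := hr.sum_add_tsum_compl (s := S)
  have h3 : ∑ m ∈ Finset.Icc (-(N : ℤ)) N, |r m| ≤ ∑ m ∈ S, |r m| :=
    Finset.sum_le_sum_of_subset_of_nonneg hS fun _ _ _ => abs_nonneg _
  rw [absTail]
  linarith

/-- The `n`-th Fejér mean of the cosine series with coefficients `r`. -/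
noncomputable def fejerMean (r : ℤ → ℝ) (n : ℕ) (l : ℝ) : ℝ :=
  (∑ i : Fin n, ∑ k : Fin n, r ((i : ℤ) - k) * Real.cos (l * ((i : ℝ) - k))) / n

/-- A uniform bound on the distance of the `n`-th Fejér mean from its limit. -/
noncomputable def fejerError (r : ℤ → ℝ) (n : ℕ) : ℝ :=
  2 * ((n : ℝ)⁻¹ * ∑ i ∈ Finset.range n, absTail r i)

theorem tendsto_fejerError (hr : Summable fun m => |r m|) :
    Tendsto (fejerError r) atTop (𝓝 0) := by
  have h := (tendsto_absTail hr).cesaro.const_mul 2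
  rw [mul_zero] at h
  exact h

theorem abs_tsum_sub_fejerMean_le (hr : Summable fun m => |r m|) {n : ℕ} (hn : 0 < n) (l : ℝ) :
    |∑' m : ℤ, r m * Real.cos (l * m) - fejerMean r n l| ≤ fejerError r n := by
  have hn0 : (0 : ℝ) < n := by exact_mod_cast hn
  set f : ℤ → ℝ := fun m => r m * Real.cos (l * m) with hf
  have hfr : ∀ m, |f m| ≤ |r m| := fun m => by
    rw [hf, abs_mul]
    exact mul_le_of_le_one_right (abs_nonneg _) (Real.abs_cos_le_one _)
  -- Row `i` contains every lag of absolute value at most min(i, n-1-i). The tail beyond that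
  -- minimum is one of the two on the right; keeping both leaves sums that are easy to average over
  -- `i`.
  have hrow : ∀ i : Fin n, |∑' m, f m - ∑ k : Fin n, f ((i : ℤ) - k)| ≤
      absTail r i + absTail r (n - 1 - i) := by
    intro i
    have himg : ∑ k : Fin n, f ((i : ℤ) - k) =
        ∑ m ∈ Finset.univ.image fun k : Fin n => (i : ℤ) - k, f m := by
      rw [Finset.sum_image]
      intro a _ b _ hab
      have : (i : ℤ) - a = (i : ℤ) - b := hab
      ext
      omega
    have hsub : ∀ N : ℕ, N ≤ i → N ≤ n - 1 - i →
        Finset.Icc (-(N : ℤ)) N ⊆ Finset.univ.image fun k : Fin n => (i : ℤ) - k := by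
      intro N h1 h2 m hm
      rw [Finset.mem_Icc] at hm
      have hi := i.2
      refine Finset.mem_image.2 ⟨⟨((i : ℤ) - m).toNat, by omega⟩, Finset.mem_univ _, ?_⟩
      simp only
      omega
    rw [himg]
    rcases le_total (i : ℕ) (n - 1 - i) with h | h
    · exact (abs_tsum_sub_sum_le_absTail hr hfr (hsub _ le_rfl h)).trans
        (le_add_of_nonneg_right (absTail_nonneg hr _))
    · exact (abs_tsum_sub_sum_le_absTail hr hfr (hsub _ h le_rfl)).trans
        (le_add_of_nonneg_left (absTail_nonneg hr _))
  have hF : fejerMean r n l = (∑ i : Fin n, ∑ k : Fin n, f ((i : ℤ) - k)) / n := by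
    simp only [fejerMean, hf]
    push_cast
    rfl
  have hS : ∑' m, f m - fejerMean r n l =
      (∑ i : Fin n, (∑' m, f m - ∑ k : Fin n, f ((i : ℤ) - k))) / n := by
    rw [hF, Finset.sum_sub_distrib, Finset.sum_const, Finset.card_univ, Fintype.card_fin,
      nsmul_eq_mul]
    field_simp
  rw [hS, abs_div, abs_of_pos hn0, div_le_iff₀ hn0, fejerError]
  have hrefl : ∑ i : Fin n, absTail r (n - 1 - i) = ∑ i ∈ Finset.range n, absTail r i := by
    rw [Fin.sum_univ_eq_sum_range (fun i => absTail r (n - 1 - i)) n, Finset.sum_range_reflect]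
  calc |∑ i : Fin n, (∑' m, f m - ∑ k : Fin n, f ((i : ℤ) - k))|
      ≤ ∑ i : Fin n, (absTail r i + absTail r (n - 1 - i)) :=
        (Finset.abs_sum_le_sum_abs _ _).trans (Finset.sum_le_sum fun i _ => hrow i)
    _ = 2 * ∑ i ∈ Finset.range n, absTail r i := by
        rw [Finset.sum_add_distrib, hrefl, Fin.sum_univ_eq_sum_range (absTail r) n]
        ring
    _ = _ := by field_simp

end Fejer

/-! ### Riemann sums -/

theorem tendsto_riemannSum {f : ℝ → ℝ} (hf : Continuous f) {T : ℝ} (hT : 0 < T) :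
    Tendsto (fun n : ℕ => (∑ j : Fin n, f (T * j / n)) / n) atTop (𝓝 (T⁻¹ * ∫ l in (0 : ℝ)..T, f l)) := by
  have huc : UniformContinuousOn f (Set.Icc 0 T) :=
    isCompact_Icc.uniformContinuousOn_of_continuous hf.continuousOn
  rw [Metric.uniformContinuousOn_iff] at huc
  rw [Metric.tendsto_atTop]
  intro ε hε
  obtain ⟨δ, hδ, H⟩ := huc (ε / 2) (by positivity)
  obtain ⟨N, hN⟩ := exists_nat_gt (T / δ)
  refine ⟨max N 1, fun n hn => ?_⟩
  have hn1 : 1 ≤ n := (le_max_right _ _).trans hn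
  have hn0 : (0 : ℝ) < n := by exact_mod_cast hn1
  have hmesh : T / n < δ := by
    rw [div_lt_iff₀ hn0, mul_comm, ← div_lt_iff₀ hδ]
    exact hN.trans_le (by exact_mod_cast (le_max_left _ _).trans hn)
  let a : ℕ → ℝ := fun j => T * j / n
  have hstep : ∀ j, a (j + 1) = a j + T / n := fun j => by
    simp only [a]
    push_cast
    ring
  have hpos : 0 < T / n := by positivity
  have hpiece : ∀ j ∈ Finset.range n,
      |∫ l in a j..a (j + 1), (f (a j) - f l)| ≤ ε / 2 * (T / n) := by
    intro j hj
    have hjn : (j : ℝ) + 1 ≤ n := by exact_mod_cast Finset.mem_range.1 hj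
    have ha0 : 0 ≤ a j := by positivity
    have haT : a (j + 1) ≤ T := by
      simp only [a]
      rw [div_le_iff₀ hn0]
      push_cast
      exact mul_le_mul_of_nonneg_left hjn hT.le
    have h := intervalIntegral.norm_integral_le_of_norm_le_const (a := a j) (b := a (j + 1))
      (f := fun l => f (a j) - f l) (C := ε / 2) (fun l hl => by
        rw [Set.uIoc_of_le (by rw [hstep]; linarith)] at hl
        refine (H (a j) ⟨ha0, by linarith [hstep j]⟩ l ⟨by linarith [hl.1], by linarith [hl.2]⟩
          ?_).le
        rw [dist_comm, Real.dist_eq, abs_of_nonneg (by linarith [hl.1])]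
        linarith [hl.2, hstep j])
    rwa [hstep, add_sub_cancel_left, abs_of_pos hpos, ← hstep, Real.norm_eq_abs] at h
  have hsum : ∑ j ∈ Finset.range n, ∫ l in a j..a (j + 1), (f (a j) - f l) =
      T * ((∑ j : Fin n, f (T * j / n)) / n) - ∫ l in (0 : ℝ)..T, f l := by
    have h1 : ∀ j, ∫ l in a j..a (j + 1), (f (a j) - f l) =
        T / n * f (a j) - ∫ l in a j..a (j + 1), f l := fun j => by
      rw [intervalIntegral.integral_sub (by simp) (hf.intervalIntegrable _ _),
        intervalIntegral.integral_const, hstep, add_sub_cancel_left, smul_eq_mul]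
    simp only [h1]
    rw [Finset.sum_sub_distrib, intervalIntegral.sum_integral_adjacent_intervals
      (fun j _ => hf.intervalIntegrable _ _), ← Finset.mul_sum,
      Fin.sum_univ_eq_sum_range (fun j : ℕ => f (T * j / n)) n]
    have hz : a 0 = 0 := by simp [a]
    have ht : a n = T := by simp only [a]; field_simp
    rw [hz, ht]
    simp only [a]
    ring
  have habs : |T * ((∑ j : Fin n, f (T * j / n)) / n) - ∫ l in (0 : ℝ)..T, f l| ≤ ε / 2 * T := by
    rw [← hsum]
    refine (Finset.abs_sum_le_sum_abs _ _).trans ((Finset.sum_le_sum hpiece).trans_eq ?_)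
    rw [Finset.sum_const, Finset.card_range, nsmul_eq_mul]
    field_simp
  rw [Real.dist_eq, show (∑ j : Fin n, f (T * j / n)) / n - T⁻¹ * ∫ l in (0 : ℝ)..T, f l =
    T⁻¹ * (T * ((∑ j : Fin n, f (T * j / n)) / n) - ∫ l in (0 : ℝ)..T, f l) by field_simp,
    abs_mul, abs_of_pos (inv_pos.2 hT), inv_mul_lt_iff₀ hT]
  nlinarith

/-! ### Covariances of stationary processes -/

section Stationary

variable {Ω : Type*} [MeasurableSpace Ω] {P : Measure Ω} {Y : ℕ → Ω → ℝ}

theorem IsStationaryProcess.covariance_add (hY : IsStationaryProcess P Y)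
    (a b k : ℕ) : cov[Y (a + k), Y (b + k); P] = cov[Y a, Y b; P] := by
  have h := hY 2 ![a, b] k
  have key : ∀ V : Ω → Fin 2 → ℝ, AEMeasurable V P →
      cov[fun ω => V ω 0, fun ω => V ω 1; P] =
        cov[fun v : Fin 2 → ℝ => v 0, fun v => v 1; P.map V] := fun V hV =>
    (covariance_map_fun (X := fun v : Fin 2 → ℝ => v 0) (Y := fun v => v 1)
      (measurable_pi_apply 0).aestronglyMeasurable
      (measurable_pi_apply 1).aestronglyMeasurable hV).symm
  have h1 := key _ h.aemeasurable_fst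
  have h2 := key _ h.aemeasurable_snd
  rw [h.map_eq, ← h2] at h1
  simpa using h1

theorem IsStationaryProcess.covariance_eq_covFun (hY : IsStationaryProcess P Y) (i k : ℕ) :
    cov[Y i, Y k; P] = covFun P Y ((i : ℤ) - k) := by
  -- `covFun` uses the pair of times whose smaller member is 0; shifting by min(i, k) reaches (i,
  -- k).
  have hi : ((i : ℤ) - k).toNat + min i k = i := by omega
  have hk : (-((i : ℤ) - k)).toNat + min i k = k := by omega
  rw [covFun, ← hY.covariance_add ((i : ℤ) - k).toNat _ (min i k), hi, hk]

theorem IsStationaryProcess.variance_sum (hY : IsStationaryProcess P Y) [IsFiniteMeasure P]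
    (h2 : ∀ n, MemLp (Y n) 2 P) {n : ℕ} (c : Fin n → ℝ) :
    Var[fun ω => ∑ i, c i * Y i ω; P] =
      ∑ i, ∑ k, c i * c k * covFun P Y ((i : ℤ) - (k : ℤ)) := by
  rw [variance_fun_sum (X := fun (i : Fin n) ω => c i * Y i ω) fun i => (h2 i).const_mul _]
  refine Finset.sum_congr rfl fun i _ => Finset.sum_congr rfl fun k _ => ?_
  rw [covariance_const_mul_left, covariance_const_mul_right, hY.covariance_eq_covFun, mul_assoc]

/-- Up to the factor 1/n, the Fejér mean is the variance of ∑ Y_i e^{i·l·√-1}, that is, of its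
cosine part plus its sine part. -/
theorem IsStationaryProcess.fejerMean_nonneg (hY : IsStationaryProcess P Y) [IsFiniteMeasure P]
    (h2 : ∀ n, MemLp (Y n) 2 P) (n : ℕ) (l : ℝ) : 0 ≤ fejerMean (covFun P Y) n l := by
  refine div_nonneg ?_ (Nat.cast_nonneg n)
  have h := add_nonneg
    (variance_nonneg (fun ω => ∑ i : Fin n, Real.cos (l * (i : ℕ)) * Y i ω) P)
    (variance_nonneg (fun ω => ∑ i : Fin n, Real.sin (l * (i : ℕ)) * Y i ω) P)
  rw [hY.variance_sum h2, hY.variance_sum h2, ← Finset.sum_add_distrib] at h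
  refine h.trans_eq (Finset.sum_congr rfl fun i _ => ?_)
  rw [← Finset.sum_add_distrib]
  refine Finset.sum_congr rfl fun k _ => ?_
  rw [mul_sub, Real.cos_sub]
  ring

/-- The variances along the rows of the Hartley matrix, averaged with symmetric weights, are given
by Fejér means. -/
theorem IsStationaryProcess.sum_variance_hartley (hY : IsStationaryProcess P Y) [IsFiniteMeasure P]
    (h2 : ∀ n, MemLp (Y n) 2 P) {n : ℕ} (hn : 0 < n) {w : ℝ → ℝ}
    (hw : ∀ l, w (2 * Real.pi - l) = w l) :
    ∑ j : Fin n, w (2 * Real.pi * j / n) *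
        Var[fun ω => ∑ i, hartleyMatrix n j i * Y i ω; P] =
      ∑ j : Fin n, w (2 * Real.pi * j / n) *
        fejerMean (covFun P Y) n (2 * Real.pi * j / n) := by
  have hs : √(n : ℝ) * √n = n := Real.mul_self_sqrt (Nat.cast_nonneg n)
  have hterm : ∀ j i k : Fin n, hartleyMatrix n j i * hartleyMatrix n j k =
      (Real.cos (2 * Real.pi * j / n * ((i : ℝ) - k)) +
        Real.sin (2 * Real.pi * j / n * ((i + k : ℕ) : ℝ))) / n := fun j i k => by
    rw [hartleyMatrix, hartleyMatrix, div_mul_div_comm, hs, Nat.cast_add, mul_sub,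
      mul_add (2 * Real.pi * (j : ℝ) / n), Real.cos_sub, Real.sin_add]
    ring
  have hvar : ∀ j : Fin n, Var[fun ω => ∑ i, hartleyMatrix n j i * Y i ω; P] =
      fejerMean (covFun P Y) n (2 * Real.pi * j / n) +
        ∑ i : Fin n, ∑ k : Fin n, covFun P Y ((i : ℤ) - k) / n *
          Real.sin (2 * Real.pi * j / n * ((i + k : ℕ) : ℝ)) := fun j => by
    rw [hY.variance_sum h2, fejerMean, Finset.sum_div, ← Finset.sum_add_distrib]
    refine Finset.sum_congr rfl fun i _ => ?_
    rw [Finset.sum_div, ← Finset.sum_add_distrib]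
    refine Finset.sum_congr rfl fun k _ => ?_
    rw [hterm]
    ring
  simp only [hvar, mul_add, Finset.sum_add_distrib]
  -- What remains is the sine part. With `i`, `k` fixed, its sum over `j` has integer frequency i +
  -- k and vanishes by the symmetry of `w`.
  rw [add_eq_left]
  simp only [Finset.mul_sum]
  rw [Finset.sum_comm]
  refine Finset.sum_eq_zero fun i _ => ?_
  rw [Finset.sum_comm]
  refine Finset.sum_eq_zero fun k _ => ?_
  have h := congrArg (fun x => covFun P Y ((i : ℤ) - k) / n * x)
    (sum_mul_sin_eq_zero_of_symm hn hw (i + k))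
  simp only [mul_zero, Finset.mul_sum] at h
  rw [← h]
  exact Finset.sum_congr rfl fun j _ => by ring

/-! ### The power spectral density -/

variable {Φ : ℝ → ℝ}

theorem IsPSD.eq_tsum_cos (hΦ : IsPSD P Y Φ) (l : ℝ) :
    Φ l = ∑' m : ℤ, covFun P Y m * Real.cos (l * m) := by
  have h := Complex.hasSum_re (hΦ.hasSum l)
  rw [Complex.ofReal_re] at h
  refine (h.tsum_eq.symm).trans (tsum_congr fun m => ?_)
  rw [Complex.re_ofReal_mul, show Complex.I * (l : ℂ) * (m : ℂ) = ((l * m : ℝ) : ℂ) * Complex.I by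
    push_cast; ring, Complex.exp_ofReal_mul_I_re]

theorem IsPSD.abs_sub_fejerMean_le (hΦ : IsPSD P Y Φ) {n : ℕ} (hn : 0 < n) (l : ℝ) :
    |Φ l - fejerMean (covFun P Y) n l| ≤ fejerError (covFun P Y) n := by
  rw [hΦ.eq_tsum_cos]
  exact abs_tsum_sub_fejerMean_le hΦ.summable hn l

/-- Φ is a limit of nonnegative Fejér means. -/
theorem IsPSD.nonneg [IsFiniteMeasure P] (hΦ : IsPSD P Y Φ) (hY : IsStationaryProcess P Y) (l : ℝ) :
    0 ≤ Φ l := by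
  have h : Tendsto (fun n => -fejerError (covFun P Y) n) atTop (𝓝 0) := by
    simpa using (tendsto_fejerError hΦ.summable).neg
  refine le_of_tendsto h ?_
  filter_upwards [eventually_gt_atTop 0] with n hn
  have h1 := (abs_le.1 (hΦ.abs_sub_fejerMean_le hn l)).1
  linarith [hY.fejerMean_nonneg hΦ.memLp n l]

theorem IsPSD.continuous (hΦ : IsPSD P Y Φ) : Continuous Φ := by
  rw [funext hΦ.eq_tsum_cos]
  refine continuous_tsum (fun m => by fun_prop) hΦ.summable fun m l => ?_
  rw [Real.norm_eq_abs, abs_mul]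
  exact mul_le_of_le_one_right (abs_nonneg _) (Real.abs_cos_le_one _)

theorem IsPSD.two_pi_sub (hΦ : IsPSD P Y Φ) (l : ℝ) : Φ (2 * Real.pi - l) = Φ l := by
  rw [hΦ.eq_tsum_cos, hΦ.eq_tsum_cos]
  refine tsum_congr fun m => ?_
  rw [sub_mul, mul_comm (2 * Real.pi) (m : ℝ), Real.cos_int_mul_two_pi_sub]

/-! ### The entropy bound -/

theorem IsPSD.shannonEntropy_block_le [IsProbabilityMeasure P] {A : Set ℝ} [Countable A]
    (hA : A.Pairwise (fun x y => 1 ≤ |x - y|)) {Z : ℕ → Ω → A} (hZ : ∀ n, Measurable (Z n))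
    (hYZ : ∀ n, ∀ᵐ ω ∂P, Y n ω = Z n ω) (hY : IsStationaryProcess P Y) (hΦ : IsPSD P Y Φ)
    {n : ℕ} (hn : 0 < n) :
    shannonEntropy P (fun ω (i : Fin n) => Y i ω) ≠ ⊤ ∧
      (shannonEntropy P (fun ω (i : Fin n) => Y i ω)).toReal / n ≤
        (Real.log (2 * Real.pi) + 1) / 2 +
          (∑ j : Fin n, Real.log (Φ (2 * Real.pi * j / n) + 1 / 12)) / n / 2 +
            6 * fejerError (covFun P Y) n := by
  have hn0 : (0 : ℝ) < n := by exact_mod_cast hn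
  set l : Fin n → ℝ := fun j => 2 * Real.pi * j / n with hl
  have hpos : ∀ x, 1 / 12 ≤ Φ x + 1 / 12 := fun x => by linarith [hΦ.nonneg hY x]
  have hpos' : ∀ x, 0 < Φ x + 1 / 12 := fun x => by linarith [hpos x]
  let d : Fin n → ℝ≥0 := fun j => ⟨Φ (l j) + 1 / 12, (hpos' _).le⟩
  have hdr : ∀ j, (d j : ℝ) = Φ (l j) + 1 / 12 := fun j => rfl
  have hd : ∀ j, d j ≠ 0 := fun j h => (hpos' (l j)).ne' (by rw [← hdr, h]; rfl)
  obtain ⟨hfin, hle⟩ := shannonEntropy_le_of_orthogonal (P := P) hA (fun i : Fin n => hZ i)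
    (fun i => (memLp_congr_ae (hYZ i)).1 (hΦ.memLp i)) (hartleyMatrix_mul_transpose hn) hd
  rw [shannonEntropy_block_eq fun i : Fin n => hYZ i]
  refine ⟨hfin, ?_⟩
  have hvar : ∀ j, Var[fun ω => ∑ i, hartleyMatrix n j i * (Z i ω : ℝ); P] =
      Var[fun ω => ∑ i, hartleyMatrix n j i * Y i ω; P] := fun j => by
    refine variance_congr ?_
    filter_upwards [ae_all_iff.2 fun i : Fin n => hYZ i] with ω hω
    simp only [hω]
  set E := fejerError (covFun P Y) n with hE
  have hE0 : 0 ≤ E := (abs_nonneg _).trans (hΦ.abs_sub_fejerMean_le hn 0)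
  have hsum : ∑ j : Fin n, (Φ (l j) + 1 / 12)⁻¹ *
      Var[fun ω => ∑ i, hartleyMatrix n j i * Y i ω; P] =
      ∑ j : Fin n, (Φ (l j) + 1 / 12)⁻¹ * fejerMean (covFun P Y) n (l j) :=
    hY.sum_variance_hartley hΦ.memLp hn (w := fun x => (Φ x + 1 / 12)⁻¹)
      fun x => by simp only [hΦ.two_pi_sub]
  -- Since Φ + 1/12 ≥ 1/12, its inverse is at most 12, so a Fejér error E costs at most 12E. Halving
  -- later gives the 6E of the statement.
  have hfej : ∀ j : Fin n, (Φ (l j) + 1 / 12)⁻¹ * (fejerMean (covFun P Y) n (l j) + 1 / 12) ≤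
      1 + 12 * E := fun j => by
    rw [inv_mul_le_iff₀ (hpos' _)]
    have h1 := (abs_le.1 (hΦ.abs_sub_fejerMean_le hn (l j))).1
    nlinarith [mul_le_mul_of_nonneg_right (hpos (l j)) hE0]
  have hquad : ∑ j : Fin n, (Φ (l j) + 1 / 12)⁻¹ *
      (Var[fun ω => ∑ i, hartleyMatrix n j i * Y i ω; P] + 1 / 12) ≤ n * (1 + 12 * E) := by
    simp only [mul_add, Finset.sum_add_distrib] at hfej ⊢
    rw [hsum, ← Finset.sum_add_distrib]
    refine (Finset.sum_le_sum fun j _ => hfej j).trans_eq ?_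
    rw [Finset.sum_const, Finset.card_univ, Fintype.card_fin, nsmul_eq_mul]
    ring
  have hrhs : ∑ j, (Real.log (2 * Real.pi * d j) / 2 +
        (Var[fun ω => ∑ i, hartleyMatrix n j i * (Z i ω : ℝ); P] + 1 / 12) / (2 * d j)) =
      n * (Real.log (2 * Real.pi) / 2) + (∑ j, Real.log (Φ (l j) + 1 / 12)) / 2 +
        (∑ j : Fin n, (Φ (l j) + 1 / 12)⁻¹ *
          (Var[fun ω => ∑ i, hartleyMatrix n j i * Y i ω; P] + 1 / 12)) / 2 := by
    rw [Finset.sum_div, Finset.sum_div, show (n : ℝ) * (Real.log (2 * Real.pi) / 2) =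
      ∑ _j : Fin n, Real.log (2 * Real.pi) / 2 by simp, ← Finset.sum_add_distrib,
      ← Finset.sum_add_distrib]
    refine Finset.sum_congr rfl fun j _ => ?_
    rw [hvar, hdr, Real.log_mul (by positivity) (hpos' _).ne', ← div_div, inv_mul_eq_div]
    field_simp
  rw [hrhs] at hle
  rw [div_le_iff₀ hn0]
  refine hle.trans ?_
  have hdiv : (∑ j, Real.log (Φ (l j) + 1 / 12)) / n / 2 * n =
      (∑ j, Real.log (Φ (l j) + 1 / 12)) / 2 := by
    rw [div_right_comm, div_mul_cancel₀ _ hn0.ne']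
  rw [add_mul, add_mul, hdiv]
  linarith

end Stationary

theorem theorem1 {Ω : Type*} [MeasurableSpace Ω] (P : Measure Ω) [IsProbabilityMeasure P]
    (Y : ℕ → Ω → ℝ) (A : Set ℝ)
    (hA : A.Pairwise (fun x y => 1 ≤ |x - y|))
    (hYA : ∀ n, ∀ᵐ ω ∂P, Y n ω ∈ A)
    (hY : IsStationaryProcess P Y)
    (Φ : ℝ → ℝ) (hΦ : IsPSD P Y Φ) :
    ∃ h : ℝ≥0, HasEntropyRate P Y (h : ℝ≥0∞) ∧
      (h : ℝ) ≤ 1 / 2 * Real.log (2 * Real.pi * Real.exp 1) +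
        1 / (4 * Real.pi) *
          ∫ l in (0 : ℝ)..(2 * Real.pi), Real.log (Φ l + 1 / 12) := by
  have hc : Countable A := countable_of_pairwise_one_le_abs_sub hA
  choose Z hZ hYZ using fun n =>
    exists_measurable_subtype_ae_eq (hΦ.memLp n).aestronglyMeasurable.aemeasurable (hYA n)
  have hblock := fun n hn => hΦ.shannonEntropy_block_le hA hZ hYZ hY (n := n) hn
  have hfin : ∀ n, shannonEntropy P (fun ω (i : Fin n) => Y i ω) ≠ ⊤ := by
    intro n
    rcases n.eq_zero_or_pos with rfl | hn
    · simp [shannonEntropy]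
    · exact (hblock n hn).1
  obtain ⟨h, hrate, hlim⟩ := hY.exists_hasEntropyRate hZ hYZ hfin
  refine ⟨h, hrate, ?_⟩
  have hcont : Continuous fun l => Real.log (Φ l + 1 / 12) :=
    (hΦ.continuous.add continuous_const).log fun l =>
      (add_pos_of_nonneg_of_pos (hΦ.nonneg hY l) (by norm_num)).ne'
  -- The Riemann sum tends to (2π)⁻¹ times the integral; halving it yields the factor 1/(4π).
  have hR := (((tendsto_riemannSum hcont Real.two_pi_pos).div_const 2).const_add
    ((Real.log (2 * Real.pi) + 1) / 2)).add ((tendsto_fejerError hΦ.summable).const_mul 6)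
  refine (le_of_tendsto_of_tendsto hlim hR ?_).trans_eq ?_
  · filter_upwards [eventually_gt_atTop 0] with n hn using (hblock n hn).2
  · rw [Real.log_mul Real.two_pi_pos.ne' (Real.exp_ne_zero _), Real.log_exp]
    generalize ∫ l in (0 : ℝ)..(2 * Real.pi), Real.log (Φ l + 1 / 12) = I
    field_simp
    ring
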